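/- Let $\mathbb{K}$ be either the real or the complex scalar field. For a locally compact Hausdorff space $K$, let $C_0(K)$ be the Banach space of continuous functions $K\to\mathbb{K}$ vanishing at infinity, with the supremum norm, and let $c_0$ be the Banach space of sequences in $\mathbb{K}$ converging to zero, with the supremum norm. For normed spaces $X$ and $Z$ over $\mathbb{K}$, let $\mathscr{B}(X,Z)$ denote the space of bounded linear operators from $X$ to $Z$, with the operator norm. **Theorem.** Let $K$ be a locally compact Hausdorff space, let $Y$ be a Banach space over $\mathbb{K}$ such that the closed unit ball of the dual space $Y^*$ is weak* sequentially compact, let $T\in\mathscr{B}(C_0(K),Y)$, and let $C>0$. Then $C_0(K)$ contains a sequence $(f_n)_{n\in\mathbb{N}}$ such that $$\sup_{k\in K}\sum_{n=1}^\infty |f_n(k)|\le 1\qquad\text{and}\qquad \inf_{n\in\mathbb{N}}\|Tf_n\|>\frac1C$$ if and only if there are operators $U\in\mathscr{B}(Y,c_0)$ and $V\in\mathscr{B}(c_0,C_0(K))$ such that $$UTV=I_{c_0}\qquad\text{and}\qquad \|U\|\,\|V\|<C,$$ where $I_{c_0}$ is the identity operator on $c_0$. (The supremum is taken in $[0,\infty]$;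 it is $0$ if $K$ is empty.) -/

import Mathlib

open scoped ZeroAtInfty

/-- The Banach space `c₀` of scalar sequences converging to zero, with the supremum norm:
continuous functions on the discrete space `ℕ` that vanish at infinity. -/
abbrev CZero (𝕜 : Type*) [RCLike 𝕜] : Type _ := C₀(ℕ, 𝕜)

/-- The closed unit ball of the dual of `Y` is weak* sequentially compact. -/
def DualBallWeakStarSeqCompact (𝕜 Y : Type*) [RCLike 𝕜] [NormedAddCommGroup Y]
    [NormedSpace 𝕜 Y] : Prop :=
  IsSeqCompact {φ : WeakDual 𝕜 Y | ‖WeakDual.toStrongDual φ‖ ≤ 1}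

open Filter Topology

/-! Rescale so that `‖T (f n)‖ = δ` for all `n`, and take norming functionals `g n`. The pointwise
ℓ¹ bound makes `f` weakly null, and `g` has a weak* convergent subsequence;
`exists_strictMono_offDiag_le` then makes the off-diagonal entries of `g i (T (f j))` summably
small. The weak* limit need not vanish, so consecutive terms are paired: half-differences of the
`g`'s define `U`, full differences of the `f`'s define `V`. Both are contractions and the diagonal
is still about `δ`, so no factor 2 is lost. Now `U T V` is within `ε` of `δ • 1`, and a Neumann
series corrects `U` at cost `1 / (δ - ε)`. Conversely, the images under `V` of the unit vectors,
divided by `‖V‖`, serve as `f`. -/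

theorem CZero.tendsto_zero {𝕜 : Type*} [RCLike 𝕜] (x : CZero 𝕜) :
    Tendsto (fun n => x n) atTop (𝓝 0) := by
  have h := zero_at_infty x
  rwa [cocompact_eq_cofinite, Nat.cofinite_eq_atTop] at h

theorem ZeroAtInftyContinuousMap.norm_le_iff {𝕜 K : Type*} [RCLike 𝕜] [TopologicalSpace K]
    (f : C₀(K, 𝕜)) {M : ℝ} (hM : 0 ≤ M) : ‖f‖ ≤ M ↔ ∀ k, ‖f k‖ ≤ M := by
  rw [← ZeroAtInftyContinuousMap.norm_toBCF_eq_norm, BoundedContinuousFunction.norm_le hM]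
  rfl

theorem ZeroAtInftyContinuousMap.norm_apply_le {𝕜 K : Type*} [RCLike 𝕜] [TopologicalSpace K]
    (f : C₀(K, 𝕜)) (k : K) : ‖f k‖ ≤ ‖f‖ :=
  (f.norm_le_iff (norm_nonneg f)).1 le_rfl k

theorem ZeroAtInftyContinuousMap.sum_apply {𝕜 K ι : Type*} [RCLike 𝕜] [TopologicalSpace K]
    (t : Finset ι) (f : ι → C₀(K, 𝕜)) (k : K) : (∑ n ∈ t, f n) k = ∑ n ∈ t, f n k := by
  classical
  induction t using Finset.induction_on with
  | empty => simp
  | insert a s ha ih => simp [Finset.sum_insert ha, ih]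

/-- The unit vectors of `c₀`. -/
noncomputable def CZero.single (𝕜 : Type*) [RCLike 𝕜] (n : ℕ) : CZero 𝕜 where
  toFun := Pi.single n 1
  continuous_toFun := continuous_of_discreteTopology
  zero_at_infty' := by
    rw [cocompact_eq_cofinite, Nat.cofinite_eq_atTop]
    refine tendsto_const_nhds.congr' ?_
    filter_upwards [eventually_gt_atTop n] with m hm
    simp [hm.ne']

theorem CZero.single_apply (𝕜 : Type*) [RCLike 𝕜] (n m : ℕ) :
    CZero.single 𝕜 n m = if m = n then 1 else 0 := by
  change (Pi.single n (1 : 𝕜) : ℕ → 𝕜) m = _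
  simp [Pi.single_apply]

theorem CZero.norm_single (𝕜 : Type*) [RCLike 𝕜] (n : ℕ) : ‖CZero.single 𝕜 n‖ = 1 := by
  apply le_antisymm
  · rw [ZeroAtInftyContinuousMap.norm_le_iff _ zero_le_one]
    intro m
    rw [CZero.single_apply]
    split_ifs <;> simp
  · simpa [CZero.single_apply] using (CZero.single 𝕜 n).norm_apply_le n

/-! ### Operators into and out of `c₀`. -/

/-- The bounded operator into `c₀` given by a weak* null sequence in the unit ball of the dual. -/
theorem exists_clm_to_cZero {𝕜 Y : Type*} [RCLike 𝕜] [NormedAddCommGroup Y] [NormedSpace 𝕜 Y]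
    (u : ℕ → StrongDual 𝕜 Y) (hu : ∀ n, ‖u n‖ ≤ 1)
    (hu0 : ∀ y, Tendsto (fun n => u n y) atTop (𝓝 0)) :
    ∃ U : Y →L[𝕜] CZero 𝕜, ‖U‖ ≤ 1 ∧ ∀ y n, U y n = u n y := by
  let L : Y →ₗ[𝕜] CZero 𝕜 :=
    { toFun := fun y =>
        { toFun := fun n => u n y
          continuous_toFun := continuous_of_discreteTopology
          zero_at_infty' := by
            rw [cocompact_eq_cofinite, Nat.cofinite_eq_atTop]
            exact hu0 y }
      map_add' := fun y z => by ext n; exact map_add (u n) y z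
      map_smul' := fun c y => by ext n; exact map_smul (u n) c y }
  have hL : ∀ y, ‖L y‖ ≤ 1 * ‖y‖ := fun y => by
    rw [ZeroAtInftyContinuousMap.norm_le_iff _ (by positivity)]
    exact fun n => (u n).le_of_opNorm_le (hu n) y
  exact ⟨L.mkContinuous 1 hL, L.mkContinuous_norm_le zero_le_one hL, fun _ _ => rfl⟩

/-- A sequence all of whose finite linear combinations are bounded by the largest coefficient
defines a contraction on `c₀`. -/
theorem exists_clm_of_cZero {𝕜 X : Type*} [RCLike 𝕜] [NormedAddCommGroup X] [NormedSpace 𝕜 X]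
    [CompleteSpace X] (w : ℕ → X)
    (hw : ∀ (t : Finset ℕ) (c : ℕ → 𝕜) (M : ℝ), 0 ≤ M → (∀ n ∈ t, ‖c n‖ ≤ M) →
      ‖∑ n ∈ t, c n • w n‖ ≤ M) :
    ∃ V : CZero 𝕜 →L[𝕜] X, ‖V‖ ≤ 1 ∧ ∀ x : CZero 𝕜, HasSum (fun n => x n • w n) (V x) := by
  have hs : ∀ x : CZero 𝕜, Summable (fun n => x n • w n) := fun x => by
    rw [summable_iff_vanishing_norm]
    intro ε hε
    obtain ⟨N, hN⟩ := Metric.tendsto_atTop.1 x.tendsto_zero (ε / 2) (half_pos hε)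
    refine ⟨Finset.range N, fun t ht => (hw t x (ε / 2) (half_pos hε).le ?_).trans_lt
      (half_lt_self hε)⟩
    intro n hn
    have hn' : N ≤ n := by
      simpa using Finset.disjoint_left.1 ht hn
    simpa using (hN n hn').le
  let L : CZero 𝕜 →ₗ[𝕜] X :=
    { toFun := fun x => ∑' n, x n • w n
      map_add' := fun x y => by
        rw [← (hs x).tsum_add (hs y)]
        simp [add_smul]
      map_smul' := fun c x => by
        rw [RingHom.id_apply, ← (hs x).tsum_const_smul]
        simp [mul_smul] }
  have hL : ∀ x, ‖L x‖ ≤ 1 * ‖x‖ := fun x => by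
    rw [one_mul]
    refine le_of_tendsto (hs x).hasSum.norm (Eventually.of_forall fun t => ?_)
    exact hw t x ‖x‖ (norm_nonneg x) fun n _ => x.norm_apply_le n
  exact ⟨L.mkContinuous 1 hL, L.mkContinuous_norm_le zero_le_one hL, fun x => (hs x).hasSum⟩

theorem RCLike.exists_norm_le_one_mul_eq_norm {𝕜 : Type*} [RCLike 𝕜] (z : 𝕜) :
    ∃ c : 𝕜, ‖c‖ ≤ 1 ∧ c * z = (‖z‖ : 𝕜) := by
  refine ⟨(starRingEnd 𝕜) z / (‖z‖ : 𝕜), ?_, ?_⟩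
  · simp only [norm_div, RCLike.norm_conj, RCLike.norm_ofReal, abs_norm]
    exact div_self_le_one _
  · by_cases h : z = 0
    · simp [h]
    · have : (‖z‖ : 𝕜) ≠ 0 := by simpa using h
      rw [div_mul_eq_mul_div, RCLike.conj_mul, pow_two, mul_div_assoc, div_self this, mul_one]

/-- A sequence all of whose finite linear combinations are bounded by the largest coefficient is
weakly null. -/
theorem tendsto_apply_zero_of_norm_sum_le {𝕜 X : Type*} [RCLike 𝕜] [NormedAddCommGroup X]
    [NormedSpace 𝕜 X] (w : ℕ → X)
    (hw : ∀ (t : Finset ℕ) (c : ℕ → 𝕜) (M : ℝ), 0 ≤ M → (∀ n ∈ t, ‖c n‖ ≤ M) →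
      ‖∑ n ∈ t, c n • w n‖ ≤ M) (φ : StrongDual 𝕜 X) :
    Tendsto (fun n => φ (w n)) atTop (𝓝 0) := by
  have hsum : Summable fun n => ‖φ (w n)‖ := by
    refine summable_of_sum_le (c := ‖φ‖) (fun n => norm_nonneg _) fun t => ?_
    choose c hc hcφ using fun n => RCLike.exists_norm_le_one_mul_eq_norm (φ (w n))
    have h1 : φ (∑ n ∈ t, c n • w n) = ((∑ n ∈ t, ‖φ (w n)‖ : ℝ) : 𝕜) := by
      simp [hcφ]
    have h2 := φ.le_opNorm_of_le (hw t c 1 zero_le_one fun n _ => hc n)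
    rw [h1, RCLike.norm_ofReal, mul_one] at h2
    exact (le_abs_self _).trans h2
  exact tendsto_zero_iff_norm_tendsto_zero.2 hsum.tendsto_atTop_zero

/-- Supplies the hypothesis `hw` needed both for weak nullity and for building `V`. -/
theorem ZeroAtInftyContinuousMap.norm_sum_smul_le {𝕜 K : Type*} [RCLike 𝕜] [TopologicalSpace K]
    (f : ℕ → C₀(K, 𝕜)) (hf : ∀ (k : K) (t : Finset ℕ), ∑ n ∈ t, ‖f n k‖ ≤ 1)
    (t : Finset ℕ) (c : ℕ → 𝕜) (M : ℝ) (hM : 0 ≤ M) (hc : ∀ n ∈ t, ‖c n‖ ≤ M) :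
    ‖∑ n ∈ t, c n • f n‖ ≤ M := by
  rw [ZeroAtInftyContinuousMap.norm_le_iff _ hM]
  intro k
  rw [ZeroAtInftyContinuousMap.sum_apply]
  calc ‖∑ n ∈ t, (c n • f n) k‖ ≤ ∑ n ∈ t, M * ‖f n k‖ := by
        refine norm_sum_le_of_le t fun n hn => ?_
        rw [ZeroAtInftyContinuousMap.smul_apply, norm_smul]
        gcongr
        exact hc n hn
    _ = M * ∑ n ∈ t, ‖f n k‖ := by rw [Finset.mul_sum]
    _ ≤ M := mul_le_of_le_one_right hM (hf k t)

/-! ### Pairing, extraction of submatrices, and perturbation of the identity. -/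

theorem sum_even_odd_le {a : ℕ → ℝ} (ha : ∀ n, 0 ≤ a n) {M : ℝ}
    (h : ∀ t : Finset ℕ, ∑ n ∈ t, a n ≤ M) (t : Finset ℕ) :
    ∑ j ∈ t, (a (2 * j) + a (2 * j + 1)) ≤ M := by
  have key : ∀ N, ∑ j ∈ Finset.range N, (a (2 * j) + a (2 * j + 1))
      = ∑ n ∈ Finset.range (2 * N), a n := fun N => by
    induction N with
    | zero => simp
    | succ N ih =>
      rw [Finset.sum_range_succ, ih, Nat.mul_succ, Finset.sum_range_succ, Finset.sum_range_succ]
      ring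
  obtain ⟨N, hN⟩ := t.exists_nat_subset_range
  refine (Finset.sum_le_sum_of_subset_of_nonneg hN fun j _ _ => add_nonneg (ha _) (ha _)).trans ?_
  rw [key]
  exact h _

/-- A matrix with null rows and convergent columns, whose column limits tend to zero, has a
submatrix with off-diagonal entries as small as desired. -/
theorem exists_strictMono_offDiag_le (a : ℕ → ℕ → ℝ) (b : ℕ → ℝ) (η : ℕ → ℝ)
    (hη : ∀ n, 0 < η n) (hanti : Antitone η)
    (hrow : ∀ i, Tendsto (fun j => a i j) atTop (𝓝 0))
    (hcol : ∀ j, Tendsto (fun i => a i j) atTop (𝓝 (b j))) (hb : Tendsto b atTop (𝓝 0)) :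
    ∃ φ : ℕ → ℕ, StrictMono φ ∧ ∀ i j, i ≠ j → a (φ i) (φ j) ≤ η j := by
  -- `p.2` is the chosen index and `p.1` a strictly increasing label, hence at least the position in
  -- the sequence; antitonicity of `η` turns bounds at labels into bounds at positions. The
  -- invariant `b p.2 < η p.1` keeps column `p.2` eventually below `η p.1`.
  obtain ⟨p, hp, hr⟩ := exists_seq_of_forall_finset_exists
    (fun p : ℕ × ℕ => b p.2 < η p.1)
    (fun p q => p.1 < q.1 ∧ p.2 < q.2 ∧ a p.2 q.2 < η q.1 ∧ a q.2 p.2 < η p.1) (by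
      intro s hs
      obtain ⟨N, hN⟩ : ∃ N, ∀ p ∈ s, p.1 < N :=
        ⟨s.sup (fun p => p.1) + 1, fun p hp =>
          Nat.lt_succ_of_le (Finset.le_sup (f := fun p : ℕ × ℕ => p.1) hp)⟩
      have hev : ∀ᶠ m in atTop, ∀ p ∈ s, p.2 < m ∧ a p.2 m < η N ∧ a m p.2 < η p.1 := by
        rw [eventually_all_finset]
        intro p hp
        exact (eventually_gt_atTop p.2).and (((hrow p.2).eventually_lt_const (hη N)).and
          ((hcol p.2).eventually_lt_const (hs p hp)))
      obtain ⟨m, hm, hm'⟩ := (hev.and (hb.eventually_lt_const (hη N))).exists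
      exact ⟨(N, m), hm', fun p hp => ⟨hN p hp, hm p hp⟩⟩)
  have hmono : StrictMono fun n => (p n).1 := fun m n hmn => (hr m n hmn).1
  refine ⟨fun n => (p n).2, fun m n hmn => (hr m n hmn).2.1, fun i j hij => ?_⟩
  refine le_trans ?_ (hanti (hmono.le_apply (x := j)))
  rcases hij.lt_or_gt with h | h
  · exact (hr i j h).2.2.1.le
  · exact (hr j i h).2.2.2.le

/-- An operator close to a positive multiple of the identity has a left inverse of controlled
norm. -/
theorem exists_left_inverse_of_norm_sub_le {𝕜 X : Type*} [RCLike 𝕜] [NormedAddCommGroup X]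
    [NormedSpace 𝕜 X] [CompleteSpace X] [Nontrivial X] (S : X →L[𝕜] X) {δ ε : ℝ} (hε : ε < δ)
    (hδ : 0 < δ) (hS : ‖(δ : 𝕜) • (1 : X →L[𝕜] X) - S‖ ≤ ε) :
    ∃ R : X →L[𝕜] X, R * S = 1 ∧ ‖R‖ ≤ 1 / (δ - ε) := by
  have hδ' : (δ : 𝕜) ≠ 0 := by simpa using hδ.ne'
  have hδn : ‖(δ : 𝕜)⁻¹‖ = δ⁻¹ := by rw [norm_inv, RCLike.norm_ofReal, abs_of_pos hδ]
  set E : X →L[𝕜] X := (δ : 𝕜)⁻¹ • ((δ : 𝕜) • (1 : X →L[𝕜] X) - S) with hE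
  have hEn : ‖E‖ ≤ δ⁻¹ * ε := by
    rw [hE, norm_smul, hδn]
    gcongr
  have hlt : δ⁻¹ * ε < 1 := by rwa [inv_mul_lt_iff₀ hδ, mul_one]
  have hE1 : 1 - E = (δ : 𝕜)⁻¹ • S := by
    rw [hE, smul_sub, smul_smul, inv_mul_cancel₀ hδ', one_smul, sub_sub_cancel]
  refine ⟨(δ : 𝕜)⁻¹ • ∑' n : ℕ, E ^ n, ?_, ?_⟩
  · rw [smul_mul_assoc, ← mul_smul_comm, ← hE1]
    exact geom_series_mul_neg E (hEn.trans_lt hlt)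
  · have h1 := tsum_geometric_le_of_norm_lt_one E (hEn.trans_lt hlt)
    rw [norm_one, sub_self, zero_add] at h1
    have h2 : (1 - ‖E‖)⁻¹ ≤ (1 - δ⁻¹ * ε)⁻¹ := by
      apply inv_anti₀ <;> linarith
    rw [norm_smul, hδn]
    calc δ⁻¹ * ‖∑' n : ℕ, E ^ n‖ ≤ δ⁻¹ * (1 - δ⁻¹ * ε)⁻¹ := by
          gcongr
          exact h1.trans h2
      _ = 1 / (δ - ε) := by
          rw [← mul_inv, mul_sub, mul_inv_cancel_left₀ hδ.ne', mul_one, one_div]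

instance CZero.instNontrivial (𝕜 : Type*) [RCLike 𝕜] : Nontrivial (CZero 𝕜) :=
  ⟨⟨CZero.single 𝕜 0, 0, fun h => by simpa [h] using CZero.norm_single 𝕜 0⟩⟩

/-! ### Construction of the factorization. -/

theorem exists_factorization_of_norm_eq {𝕜 : Type*} [RCLike 𝕜] {K : Type*} [TopologicalSpace K]
    {Y : Type*} [NormedAddCommGroup Y] [NormedSpace 𝕜 Y]
    (hY : DualBallWeakStarSeqCompact 𝕜 Y) (T : C₀(K, 𝕜) →L[𝕜] Y) {δ ε : ℝ} (hε : 0 < ε)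
    (hεδ : ε < δ) (f : ℕ → C₀(K, 𝕜)) (hf : ∀ (k : K) (t : Finset ℕ), ∑ n ∈ t, ‖f n k‖ ≤ 1)
    (hTf : ∀ n, ‖T (f n)‖ = δ) :
    ∃ (U : Y →L[𝕜] CZero 𝕜) (V : CZero 𝕜 →L[𝕜] C₀(K, 𝕜)),
      U ∘L T ∘L V = ContinuousLinearMap.id 𝕜 (CZero 𝕜) ∧ ‖U‖ ≤ 1 / (δ - ε) ∧ ‖V‖ ≤ 1 := by
  have hδ : 0 < δ := hε.trans hεδ
  choose g hg hgT using fun n => exists_dual_vector 𝕜 (T (f n)) (by rw [hTf]; exact hδ.ne')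
  obtain ⟨γ, -, ψ, hψ, hγ⟩ := hY (x := fun n => StrongDual.toWeakDual (g n))
    (fun n => (hg n).le)
  have hlim : ∀ y, Tendsto (fun n => g (ψ n) y) atTop (𝓝 (γ y)) := fun y =>
    ((WeakDual.eval_continuous (𝕜 := 𝕜) y).tendsto γ).comp hγ
  have hnull : ∀ φ : StrongDual 𝕜 Y, Tendsto (fun n => φ (T (f n))) atTop (𝓝 0) := fun φ =>
    tendsto_apply_zero_of_norm_sum_le f
      (ZeroAtInftyContinuousMap.norm_sum_smul_le f hf) (φ ∘L T)
  -- An entry of the paired matrix errs by half of at most four terms of size `η j`; the factor `ε /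
  -- 4` makes these errors `2 * η j` sum to `ε`.
  let η : ℕ → ℝ := fun n => ε / 4 * (1 / 2) ^ n
  have hηpos : ∀ n, 0 < η n := fun n => by positivity
  have hηanti : Antitone η := fun m n hmn =>
    mul_le_mul_of_nonneg_left (pow_le_pow_of_le_one (by norm_num) (by norm_num) hmn) (by positivity)
  have hηsum : HasSum (fun n => 2 * η n) ε := by
    have := hasSum_geometric_two.mul_left (ε / 2)
    rw [div_mul_cancel₀ ε two_ne_zero] at this
    have hη : (fun n => 2 * η n) = fun n => ε / 2 * (1 / 2) ^ n := by
      funext n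
      change 2 * (ε / 4 * (1 / 2) ^ n) = _
      ring
    rwa [hη]
  obtain ⟨φ, hφ, hoff⟩ := exists_strictMono_offDiag_le
    (fun i j => ‖g (ψ i) (T (f (ψ j)))‖) (fun j => ‖γ (T (f (ψ j)))‖) η hηpos hηanti
    (fun i => tendsto_zero_iff_norm_tendsto_zero.1 ((hnull (g (ψ i))).comp hψ.tendsto_atTop))
    (fun j => (hlim _).norm)
    (tendsto_zero_iff_norm_tendsto_zero.1
      ((hnull (WeakDual.toStrongDual γ)).comp hψ.tendsto_atTop))
  let F : ℕ → C₀(K, 𝕜) := fun n => f (ψ (φ n))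
  let G : ℕ → StrongDual 𝕜 Y := fun n => g (ψ (φ n))
  have hGn : ∀ n, ‖G n‖ = 1 := fun n => hg _
  have hoff' : ∀ i j, i ≠ j → ‖G i (T (F j))‖ ≤ η j := hoff
  have hdiag : ∀ i, G i (T (F i)) = (δ : 𝕜) := fun i => by
    simp only [G, F, hgT, hTf]
  have hF : ∀ (k : K) (t : Finset ℕ), ∑ n ∈ t, ‖F n k‖ ≤ 1 := fun k t => by
    have := hf k (t.map ⟨ψ ∘ φ, (hψ.comp hφ).injective⟩)
    rwa [Finset.sum_map] at this
  have hGlim : ∀ y, Tendsto (fun n => G n y) atTop (𝓝 (γ y)) := fun y =>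
    (hlim y).comp hφ.tendsto_atTop
  have htwo : ‖(2⁻¹ : 𝕜)‖ = 2⁻¹ := by simp
  -- Subtraction cancels the limit `γ`, and the factor `2⁻¹` keeps the norm at most 1. Against `w
  -- j`, the two diagonal entries contribute `(δ + δ) / 2 = δ`.
  let u : ℕ → StrongDual 𝕜 Y := fun j => (2⁻¹ : 𝕜) • (G (2 * j) - G (2 * j + 1))
  obtain ⟨U, hU, hUa⟩ := exists_clm_to_cZero u
    (fun n => by
      have := norm_sub_le (G (2 * n)) (G (2 * n + 1))
      rw [hGn, hGn] at this
      simp only [u]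
      rw [norm_smul, htwo]
      linarith)
    (fun y => by
      have h0 : Tendsto (fun j : ℕ => 2 * j) atTop atTop :=
        tendsto_id.const_mul_atTop' two_pos
      have h1 := (((hGlim y).comp h0).sub
        ((hGlim y).comp ((tendsto_add_atTop_nat 1).comp h0))).const_mul (2⁻¹ : 𝕜)
      rw [sub_self, mul_zero] at h1
      exact h1)
  let w : ℕ → C₀(K, 𝕜) := fun j => F (2 * j) - F (2 * j + 1)
  obtain ⟨V, hV, hVa⟩ := exists_clm_of_cZero w
    (ZeroAtInftyContinuousMap.norm_sum_smul_le w fun k t =>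
      (Finset.sum_le_sum fun j _ => norm_sub_le _ _).trans
        (sum_even_odd_le (fun n => norm_nonneg (F n k)) (hF k) t))
  have hentry : ∀ i j, ‖(if i = j then (δ : 𝕜) else 0) - u i (T (w j))‖ ≤ 2 * η j := by
    intro i j
    have e : ∀ a b : ℕ, a ≠ b → j ≤ b → ‖G a (T (F b))‖ ≤ η j := fun a b hab hb =>
      (hoff' a b hab).trans (hηanti hb)
    have huw : u i (T (w j)) = 2⁻¹ * ((G (2 * i) (T (F (2 * j))) - G (2 * i) (T (F (2 * j + 1))))
        - (G (2 * i + 1) (T (F (2 * j))) - G (2 * i + 1) (T (F (2 * j + 1))))) := by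
      simp [u, w]
    have hbd : ∀ a b c d : 𝕜, ‖a‖ ≤ η j → ‖b‖ ≤ η j → ‖c‖ ≤ η j → ‖d‖ ≤ η j →
        ‖2⁻¹ * ((a - b) - (c - d))‖ ≤ 2 * η j := fun a b c d ha hb hc hd => by
      have h1 := norm_sub_le (a - b) (c - d)
      have h2 := norm_sub_le a b
      have h3 := norm_sub_le c d
      rw [norm_mul, htwo]
      linarith
    by_cases hij : i = j
    · subst hij
      rw [if_pos rfl, huw, hdiag, hdiag]
      have hz : ‖(0 : 𝕜)‖ ≤ η i := by rw [norm_zero]; exact (hηpos i).le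
      -- The zeros stand for the two diagonal entries, which cancel against `δ` exactly.
      have h := hbd 0 (G (2 * i) (T (F (2 * i + 1)))) (G (2 * i + 1) (T (F (2 * i)))) 0 hz
        (e _ _ (by omega) (by omega)) (e _ _ (by omega) (by omega)) hz
      rw [← norm_neg]
      have h2 : (2 : 𝕜) * 2⁻¹ = 1 := mul_inv_cancel₀ two_ne_zero
      have h3 : ∀ A B : 𝕜, -((δ : 𝕜) - 2⁻¹ * ((δ : 𝕜) - A - (B - (δ : 𝕜))))
          = 2⁻¹ * (0 - A - (B - 0)) := fun A B => by
        linear_combination (δ : 𝕜) * h2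
      rwa [h3]
    · rw [if_neg hij, zero_sub, norm_neg, huw]
      exact hbd _ _ _ _ (e _ _ (by omega) (by omega)) (e _ _ (by omega) (by omega))
        (e _ _ (by omega) (by omega)) (e _ _ (by omega) (by omega))
  have hS : ‖(δ : 𝕜) • (1 : CZero 𝕜 →L[𝕜] CZero 𝕜) - U ∘L T ∘L V‖ ≤ ε := by
    refine ContinuousLinearMap.opNorm_le_bound _ hε.le fun x => ?_
    rw [ZeroAtInftyContinuousMap.norm_le_iff _ (by positivity)]
    intro i
    have h1 : HasSum (fun j => x j * u i (T (w j))) (U (T (V x)) i) := by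
      rw [hUa]
      have := (hVa x).mapL (u i ∘L T)
      simpa using this
    have h2 : HasSum (fun j => x j * (if i = j then (δ : 𝕜) else 0)) (x i * δ) := by
      have := hasSum_single (f := fun j => x j * (if i = j then (δ : 𝕜) else 0)) i
        (fun j hj => by rw [if_neg hj.symm, mul_zero])
      simpa using this
    have h3 := h2.sub h1
    have h4 : (((δ : 𝕜) • (1 : CZero 𝕜 →L[𝕜] CZero 𝕜) - U ∘L T ∘L V) x) i
        = x i * δ - U (T (V x)) i := by
      simp [RCLike.real_smul_eq_coe_mul, mul_comm]
    rw [h4, ← h3.tsum_eq]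
    -- The entry bound depends only on the column, so every row has error sum at most `ε`.
    refine tsum_of_norm_bounded (hηsum.mul_right ‖x‖) fun j => ?_
    rw [← mul_sub, norm_mul, mul_comm]
    exact mul_le_mul (hentry i j) (x.norm_apply_le j) (norm_nonneg _)
      (mul_nonneg zero_le_two (hηpos j).le)
  obtain ⟨R, hR, hRn⟩ := exists_left_inverse_of_norm_sub_le _ hεδ hδ hS
  refine ⟨R ∘L U, V, hR, ?_, hV⟩
  calc ‖R ∘L U‖ ≤ ‖R‖ * ‖U‖ := ContinuousLinearMap.opNorm_comp_le _ _
    _ ≤ ‖R‖ := mul_le_of_le_one_right (norm_nonneg R) hU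
    _ ≤ _ := hRn

/-! ### The converse and the equivalence. -/

theorem iSup_tsum_enorm_le_one_iff {𝕜 K : Type*} [RCLike 𝕜] [TopologicalSpace K]
    (f : ℕ → C₀(K, 𝕜)) :
    (⨆ k : K, ∑' n : ℕ, ‖f n k‖ₑ) ≤ 1 ↔ ∀ (k : K) (t : Finset ℕ), ∑ n ∈ t, ‖f n k‖ ≤ 1 := by
  simp only [iSup_le_iff, ENNReal.tsum_eq_iSup_sum]
  refine forall_congr' fun k => forall_congr' fun t => ?_
  rw [← ENNReal.ofReal_le_one, ENNReal.ofReal_sum_of_nonneg fun n _ => norm_nonneg _]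
  simp only [ofReal_norm]

/-- Rotating each coefficient to make its term nonnegative turns the sum into the value at `k` of `V
x` for a single `x` in the unit ball of `c₀`. -/
theorem sum_norm_apply_single_le {𝕜 K : Type*} [RCLike 𝕜] [TopologicalSpace K]
    (V : CZero 𝕜 →L[𝕜] C₀(K, 𝕜)) (k : K) (t : Finset ℕ) :
    ∑ n ∈ t, ‖V (CZero.single 𝕜 n) k‖ ≤ ‖V‖ := by
  let v : ℕ → 𝕜 := fun n => V (CZero.single 𝕜 n) k
  choose c hc hcv using fun n => RCLike.exists_norm_le_one_mul_eq_norm (v n)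
  let x : CZero 𝕜 := ∑ n ∈ t, c n • CZero.single 𝕜 n
  have hx : ‖x‖ ≤ 1 := by
    rw [ZeroAtInftyContinuousMap.norm_le_iff _ zero_le_one]
    intro m
    simp only [x, ZeroAtInftyContinuousMap.sum_apply, ZeroAtInftyContinuousMap.smul_apply,
      CZero.single_apply, smul_eq_mul, mul_ite, mul_one, mul_zero, Finset.sum_ite_eq]
    split_ifs
    · exact hc m
    · simp
  have h1 : V x k = ((∑ n ∈ t, ‖v n‖ : ℝ) : 𝕜) := by
    simp only [x, map_sum, map_smul, ZeroAtInftyContinuousMap.sum_apply,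
      ZeroAtInftyContinuousMap.smul_apply, smul_eq_mul]
    exact Finset.sum_congr rfl fun n _ => hcv n
  have h2 := ((V x).norm_apply_le k).trans (V.le_opNorm_of_le hx)
  rw [h1, RCLike.norm_ofReal, mul_one] at h2
  exact (le_abs_self _).trans h2

theorem mainTheorem2 {𝕜 : Type*} [RCLike 𝕜]
    {K : Type*} [TopologicalSpace K] [LocallyCompactSpace K] [T2Space K]
    {Y : Type*} [NormedAddCommGroup Y] [NormedSpace 𝕜 Y] [CompleteSpace Y]
    (hY : DualBallWeakStarSeqCompact 𝕜 Y)
    (T : C₀(K, 𝕜) →L[𝕜] Y) (C : ℝ) (hC : 0 < C) :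
    (∃ f : ℕ → C₀(K, 𝕜),
        (⨆ k : K, ∑' n : ℕ, ‖f n k‖ₑ) ≤ 1 ∧ 1 / C < ⨅ n : ℕ, ‖T (f n)‖) ↔
      ∃ (U : Y →L[𝕜] CZero 𝕜) (V : CZero 𝕜 →L[𝕜] C₀(K, 𝕜)),
        U ∘L T ∘L V = ContinuousLinearMap.id 𝕜 (CZero 𝕜) ∧ ‖U‖ * ‖V‖ < C := by
  constructor
  · rintro ⟨f, hf, hT⟩
    rw [iSup_tsum_enorm_le_one_iff] at hf
    set δ : ℝ := ⨅ n : ℕ, ‖T (f n)‖ with hδdef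
    have hle : ∀ n, δ ≤ ‖T (f n)‖ := fun n =>
      ciInf_le ⟨0, by rintro _ ⟨m, rfl⟩; exact norm_nonneg _⟩ n
    have hC' : 0 < 1 / C := one_div_pos.2 hC
    have hδ : 0 < δ := hC'.trans hT
    have hpos : ∀ n, 0 < ‖T (f n)‖ := fun n => hδ.trans_le (hle n)
    have hr : ∀ n, ‖((δ / ‖T (f n)‖ : ℝ) : 𝕜)‖ = δ / ‖T (f n)‖ := fun n => by
      rw [RCLike.norm_ofReal, abs_of_pos (div_pos hδ (hpos n))]
    -- With `ε` half the gap, `δ - ε` still exceeds `1 / C`. The rescaling factors are at most 1, so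
    -- the pointwise bound survives.
    obtain ⟨U, V, hUV, hU, hV⟩ := exists_factorization_of_norm_eq hY T (δ := δ)
      (ε := (δ - 1 / C) / 2) (by linarith) (by linarith)
      (fun n => ((δ / ‖T (f n)‖ : ℝ) : 𝕜) • f n)
      (fun k t => (Finset.sum_le_sum fun n _ => by
        rw [ZeroAtInftyContinuousMap.smul_apply, norm_smul, hr]
        exact mul_le_of_le_one_left (norm_nonneg _)
          ((div_le_one (hpos n)).2 (hle n))).trans (hf k t))
      (fun n => by rw [map_smul, norm_smul, hr, div_mul_cancel₀ _ (hpos n).ne'])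
    refine ⟨U, V, hUV, ?_⟩
    calc ‖U‖ * ‖V‖ ≤ ‖U‖ := mul_le_of_le_one_right (norm_nonneg U) hV
      _ ≤ 1 / (δ - (δ - 1 / C) / 2) := hU
      _ < 1 / (1 / C) := one_div_lt_one_div_of_lt hC' (by linarith)
      _ = C := one_div_one_div C
  · rintro ⟨U, V, hUV, hlt⟩
    -- After division by `‖V‖` this gives the lower bound `1 / (‖U‖ * ‖V‖)`, uniform in `n` and
    -- larger than `1 / C`.
    have hone : ∀ n, 1 ≤ ‖U‖ * ‖T (V (CZero.single 𝕜 n))‖ := fun n => by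
      have h1 : U (T (V (CZero.single 𝕜 n))) = CZero.single 𝕜 n :=
        DFunLike.congr_fun hUV (CZero.single 𝕜 n)
      rw [← CZero.norm_single 𝕜 n]
      nth_rewrite 1 [← h1]
      exact U.le_opNorm _
    have hU : 0 < ‖U‖ := (norm_nonneg U).lt_of_ne fun h => by
      have := hone 0
      rw [← h, zero_mul] at this
      linarith
    have hV : 0 < ‖V‖ := (norm_nonneg V).lt_of_ne fun h => by
      have := hone 0
      have h1 := T.le_opNorm_of_le (V.le_opNorm (CZero.single 𝕜 0))
      rw [← h, zero_mul, mul_zero] at h1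
      have h2 := mul_le_mul_of_nonneg_left h1 hU.le
      linarith
    have hVn : ‖((‖V‖⁻¹ : ℝ) : 𝕜)‖ = ‖V‖⁻¹ := by
      rw [RCLike.norm_ofReal, abs_of_pos (inv_pos.2 hV)]
    refine ⟨fun n => ((‖V‖⁻¹ : ℝ) : 𝕜) • V (CZero.single 𝕜 n), ?_, ?_⟩
    · rw [iSup_tsum_enorm_le_one_iff]
      intro k t
      simp only [ZeroAtInftyContinuousMap.smul_apply, norm_smul, hVn]
      rw [← Finset.mul_sum, inv_mul_le_iff₀ hV, mul_one]
      exact sum_norm_apply_single_le V k t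
    · refine (one_div_lt_one_div_of_lt (mul_pos hU hV) hlt).trans_le (le_ciInf fun n => ?_)
      rw [map_smul, norm_smul, hVn, one_div, mul_inv, mul_comm]
      gcongr
      rw [inv_le_iff_one_le_mul₀ hU, mul_comm]
      exact hone n
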